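/- Let $n \ge 0$ be an integer and $R = \lfloor n/2 \rfloor$. Let $N \subset GL(n,\mathbb{R})$ be the group of upper triangular matrices with all diagonal entries equal to $1$, $\mathfrak{n}$ its Lie algebra of strictly upper triangular matrices, and $\mathfrak{n}_-$ the space of strictly lower triangular real $n\times n$ matrices. Identify $\mathfrak{n}^*$ with $\mathfrak{n}_-$ through the trace form $(X,Y) = \operatorname{Tr}(XY)$; the co-adjoint action of $g \in N$ is then $X \mapsto \pi_-(g^{-1} X g)$ for $X \in \mathfrak{n}_-$, where $\pi_-$ is the projection of $\mathfrak{gl}(n,\mathbb{R})$ onto $\mathfrak{n}_-$ that keeps the entries strictly below the diagonal. Let $\mathbb{R}[\mathfrak{n}_-]^N$ be the algebra of real polynomials $f$ on $\mathfrak{n}_-$ (polynomials in the matrix entries below the diagonal) such that $f(\pi_-(g^{-1}Xg)) = f(X)$ for all $g \in N$ and $X \in \mathfrak{n}_-$. For $1 \le r \le R$ let $(X - \eta\mathbb{I})_{(r)}$ (the $r$-chop) be the matrix obtained from $X - \eta\mathbb{I}$ by removing the first $r$ rows and the last $r$ columns, and let $E_{0,r}(X)$, a polynomial on $\mathfrak{n}_-$,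 be the coefficient of $\eta^{n-2r}$ in $\det (X - \eta\mathbb{I})_{(r)}$, which has degree at most $n-2r$ in $\eta$. Then $$\mathbb{R}[\mathfrak{n}_-]^N = \mathbb{R}[E_{0,1}, \dots, E_{0,R}],$$ and the right-hand side is a polynomial ring: the algebra $\mathbb{R}[\mathfrak{n}_-]^N$ is generated over $\mathbb{R}$ by $E_{0,1}, \dots, E_{0,R}$, and these are algebraically independent over $\mathbb{R}$. Moreover, each $E_{0,r}$ is homogeneous of degree $r$. -/

import Mathlib

open scoped Matrix

namespace NInvar

/-- The Lie algebra `𝔫` of strictly upper triangular real `n × n` matrices (as a vector space). -/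
def upperNilp (n : ℕ) : Submodule ℝ (Matrix (Fin n) (Fin n) ℝ) where
  carrier := {Y | ∀ i j, j ≤ i → Y i j = 0}
  add_mem' := by
    intro a b ha hb i j h
    simp [ha i j h, hb i j h]
  zero_mem' := by
    intro i j _
    rfl
  smul_mem' := by
    intro c a ha i j h
    simp [ha i j h]

/-- The space `𝔫₋` of strictly lower triangular real `n × n` matrices. It represents the dual
of `𝔫` through the trace form `(X, Y) = Tr (X Y)`. -/
def lowerNilp (n : ℕ) : Submodule ℝ (Matrix (Fin n) (Fin n) ℝ) where
  carrier := {X | ∀ i j, i ≤ j → X i j = 0}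
  add_mem' := by
    intro a b ha hb i j h
    simp [ha i j h, hb i j h]
  zero_mem' := by
    intro i j _
    rfl
  smul_mem' := by
    intro c a ha i j h
    simp [ha i j h]

/-- The projection `π₋ : 𝔤𝔩 → 𝔫₋`, which keeps the entries strictly below the diagonal. -/
def lowerProj (n : ℕ) : Matrix (Fin n) (Fin n) ℝ →ₗ[ℝ] lowerNilp n where
  toFun M := ⟨Matrix.of fun i j => if j < i then M i j else 0, by
    intro i j h
    simp [not_lt.mpr h]⟩
  map_add' := by
    intro a b
    ext i j
    by_cases h : j < i <;> simp [h]
  map_smul' := by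
    intro c a
    ext i j
    by_cases h : j < i <;> simp [h]

/-- Upper triangular with all diagonal entries equal to one. -/
def IsUpperUnipotent {n : ℕ} (M : Matrix (Fin n) (Fin n) ℝ) : Prop :=
  (∀ i j, j < i → M i j = 0) ∧ ∀ i, M i i = 1

theorem diag_mul {n : ℕ} {M K : Matrix (Fin n) (Fin n) ℝ}
    (hM : ∀ i j, j < i → M i j = 0) (hK : ∀ i j, j < i → K i j = 0) (i : Fin n) :
    (M * K) i i = M i i * K i i := by
  rw [Matrix.mul_apply]
  refine Finset.sum_eq_single i ?_ (by simp)
  intro k _ hk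
  rcases lt_or_gt_of_ne hk with h | h
  · simp [hM i k h]
  · simp [hK k i h]

/-- The group `N` of upper unipotent matrices, a subgroup of `GL(n, ℝ)`. -/
def upperUnipotent (n : ℕ) : Subgroup (GL (Fin n) ℝ) where
  carrier := {g | IsUpperUnipotent (g : Matrix (Fin n) (Fin n) ℝ)}
  one_mem' := by
    refine ⟨fun i j h => ?_, fun i => ?_⟩
    · simp [h.ne']
    · simp
  mul_mem' := by
    intro a b ha hb
    refine ⟨fun i j h => ?_, fun i => ?_⟩
    · have hA : Matrix.BlockTriangular (a : Matrix (Fin n) (Fin n) ℝ) id := fun _ _ h => ha.1 _ _ h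
      have hB : Matrix.BlockTriangular (b : Matrix (Fin n) (Fin n) ℝ) id := fun _ _ h => hb.1 _ _ h
      exact (hA.mul hB) h
    · rw [Units.val_mul, diag_mul ha.1 hb.1, ha.2, hb.2, one_mul]
  inv_mem' := by
    intro a ha
    have hA : Matrix.BlockTriangular (a : Matrix (Fin n) (Fin n) ℝ) id := fun _ _ h => ha.1 _ _ h
    have hI : ∀ i j, j < i → ((a⁻¹ : GL (Fin n) ℝ) : Matrix (Fin n) (Fin n) ℝ) i j = 0 := by
      intro i j h
      rw [Matrix.coe_units_inv]
      have : Invertible (a : Matrix (Fin n) (Fin n) ℝ) := a.invertible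
      exact (Matrix.blockTriangular_inv_of_blockTriangular hA) h
    refine ⟨hI, fun i => ?_⟩
    have h1 : ((a : Matrix (Fin n) (Fin n) ℝ) *
        ((a⁻¹ : GL (Fin n) ℝ) : Matrix (Fin n) (Fin n) ℝ)) i i = 1 := by
      rw [← Units.val_mul]
      simp
    rw [diag_mul ha.1 hI, ha.2, one_mul] at h1
    exact h1

/-- The co-adjoint action of `g ∈ N` on `𝔫* ≅ 𝔫₋`, i.e. `X ↦ π₋ (g⁻¹ X g)`. -/
def coadjoint {n : ℕ} (g : upperUnipotent n) (X : lowerNilp n) : lowerNilp n :=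
  lowerProj n ((((g : GL (Fin n) ℝ)⁻¹ : GL (Fin n) ℝ) : Matrix (Fin n) (Fin n) ℝ) *
    (X : Matrix (Fin n) (Fin n) ℝ) * ((g : GL (Fin n) ℝ) : Matrix (Fin n) (Fin n) ℝ))

theorem trace_lowerProj {n : ℕ} (M : Matrix (Fin n) (Fin n) ℝ) (Y : upperNilp n) :
    ((lowerProj n M : Matrix (Fin n) (Fin n) ℝ) * (Y : Matrix (Fin n) (Fin n) ℝ)).trace =
      (M * (Y : Matrix (Fin n) (Fin n) ℝ)).trace := by
  simp only [Matrix.trace, Matrix.diag, Matrix.mul_apply]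
  refine Finset.sum_congr rfl fun i _ => Finset.sum_congr rfl fun j _ => ?_
  by_cases h : j < i
  · simp [lowerProj, h]
  · rw [Y.2 j i (not_lt.mp h)]
    simp

/-- Through the trace form, `coadjoint g` is the transpose of `Y ↦ g Y g⁻¹` on `𝔫`. -/
theorem trace_coadjoint {n : ℕ} (g : upperUnipotent n) (X : lowerNilp n) (Y : upperNilp n) :
    ((coadjoint g X : Matrix (Fin n) (Fin n) ℝ) * (Y : Matrix (Fin n) (Fin n) ℝ)).trace =
      ((X : Matrix (Fin n) (Fin n) ℝ) *
        (((g : GL (Fin n) ℝ) : Matrix (Fin n) (Fin n) ℝ) * (Y : Matrix (Fin n) (Fin n) ℝ) *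
          (((g : GL (Fin n) ℝ)⁻¹ : GL (Fin n) ℝ) : Matrix (Fin n) (Fin n) ℝ))).trace := by
  rw [coadjoint, trace_lowerProj, Matrix.mul_assoc, Matrix.mul_assoc, Matrix.trace_mul_comm]
  simp only [Matrix.mul_assoc]

/-- The positions strictly below the diagonal; they index the linear coordinates on `𝔫₋`. -/
abbrev LowerIdx (n : ℕ) : Type := {p : Fin n × Fin n // p.2 < p.1}

/-- The algebra of real polynomials on `𝔫₋ ≅ 𝔫*`, in the matrix entries below the diagonal. -/
abbrev PolyOnLower (n : ℕ) : Type := MvPolynomial (LowerIdx n) ℝ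

/-- The coordinates of a point of `𝔫₋`. -/
def coords {n : ℕ} (X : lowerNilp n) : LowerIdx n → ℝ :=
  fun p => (X : Matrix (Fin n) (Fin n) ℝ) p.1.1 p.1.2

/-- The algebra of polynomials on `𝔫₋ ≅ 𝔫*` invariant under the co-adjoint action of `N`. -/
def invariants (n : ℕ) : Subalgebra ℝ (PolyOnLower n) where
  carrier := {f | ∀ (g : upperUnipotent n) (X : lowerNilp n),
    MvPolynomial.eval (coords (coadjoint g X)) f = MvPolynomial.eval (coords X) f}
  mul_mem' := by
    intro a b ha hb g X
    simp [ha g X, hb g X]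
  add_mem' := by
    intro a b ha hb g X
    simp [ha g X, hb g X]
  algebraMap_mem' := by
    intro c g X
    simp [MvPolynomial.algebraMap_eq]

/-- Removal of the first `r` rows and the last `r` columns of an `n × n` matrix. -/
def chop {A : Type*} {n : ℕ} (r : ℕ) (M : Matrix (Fin n) (Fin n) A) :
    Matrix (Fin (n - r)) (Fin (n - r)) A :=
  M.submatrix (fun i => ⟨r + i.1, by omega⟩) (fun j => ⟨j.1, by omega⟩)

/-- The determinant of the `r`-chop of `X - η 𝕀`, as a polynomial in `η`. -/
noncomputable def chopDet {A : Type*} [CommRing A] {n : ℕ} (r : ℕ)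
    (M : Matrix (Fin n) (Fin n) A) : Polynomial A :=
  (chop r (M.map Polynomial.C - (Polynomial.X : Polynomial A) • 1)).det

/-- The coefficient `E_{m,r}` in `det (X - η 𝕀)_(r) = E_{0,r} η^(n-2r) + ⋯ + E_{n-2r,r}`,
for `r ≤ ⌊n/2⌋` and `m ≤ n - 2r`. -/
noncomputable def chopCoeff {A : Type*} [CommRing A] {n : ℕ} (m r : ℕ)
    (M : Matrix (Fin n) (Fin n) A) : A :=
  (chopDet r M).coeff (n - 2 * r - m)

/-- The generic point of `𝔫₋`: its entries below the diagonal are the coordinate functions. -/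
noncomputable def genericLower (n : ℕ) : Matrix (Fin n) (Fin n) (PolyOnLower n) :=
  Matrix.of fun i j => if h : j < i then MvPolynomial.X ⟨(i, j), h⟩ else 0

/-- `E_{0,r}` as a polynomial on `𝔫₋`. -/
noncomputable def leadCoeff (n r : ℕ) : PolyOnLower n :=
  chopCoeff 0 r (genericLower n)

theorem map_chopDet {A B : Type*} [CommRing A] [CommRing B] (φ : A →+* B) {n : ℕ} (r : ℕ)
    (M : Matrix (Fin n) (Fin n) A) :
    (chopDet r M).map φ = chopDet r (M.map φ) := by
  rw [chopDet, chopDet, ← Polynomial.coe_mapRingHom, RingHom.map_det]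
  congr 1
  ext1 i j
  by_cases h : (⟨r + i.1, by omega⟩ : Fin n) = ⟨j.1, by omega⟩ <;>
    simp [chop, h]

/-- The value of the polynomial `E_{0,r}` at `X ∈ 𝔫₋` is the number `E_{0,r}(X)`. -/
theorem eval_leadCoeff {n : ℕ} (r : ℕ) (X : lowerNilp n) :
    MvPolynomial.eval (coords X) (leadCoeff n r) =
      chopCoeff 0 r (X : Matrix (Fin n) (Fin n) ℝ) := by
  have hX : (genericLower n).map (MvPolynomial.eval (coords X)) =
      (X : Matrix (Fin n) (Fin n) ℝ) := by
    ext i j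
    by_cases h : j < i
    · simp [genericLower, h, coords]
    · simp [genericLower, h, X.2 i j (not_lt.mp h)]
  rw [leadCoeff, chopCoeff, chopCoeff, ← Polynomial.coeff_map, map_chopDet, hX]

/-- For `r ≤ ⌊n/2⌋` no power of `η` above `η^(n-2r)` occurs in the determinant of the `r`-chop. -/
theorem natDegree_chopDet_le {A : Type*} [CommRing A] {n r : ℕ} (hr : r ≤ n / 2)
    (M : Matrix (Fin n) (Fin n) A) : (chopDet r M).natDegree ≤ n - 2 * r := by
  rw [chopDet, Matrix.det_apply]
  refine Polynomial.natDegree_sum_le_of_forall_le _ _ fun s _ => ?_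
  refine (Polynomial.natDegree_smul_le _ _).trans ((Polynomial.natDegree_prod_le _ _).trans ?_)
  have key : ∀ i : Fin (n - r), (chop r (M.map Polynomial.C -
      (Polynomial.X : Polynomial A) • 1) (s i) i).natDegree ≤ if r ≤ i.1 then 1 else 0 := by
    intro i
    by_cases h : r ≤ i.1
    · rw [if_pos h]
      by_cases h2 : (⟨r + (s i).1, by omega⟩ : Fin n) = ⟨i.1, by omega⟩
      · simp only [chop, Matrix.submatrix_apply, Matrix.sub_apply, Matrix.map_apply,
          Matrix.smul_apply, h2, Matrix.one_apply_eq, smul_eq_mul, mul_one]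
        exact (Polynomial.natDegree_sub_le _ _).trans
          (max_le (by simp) Polynomial.natDegree_X_le)
      · simp [chop, h2]
    · have hne : (⟨r + (s i).1, by omega⟩ : Fin n) ≠ ⟨i.1, by omega⟩ := by
        intro e
        have := congrArg Fin.val e
        simp only at this
        omega
      simp [chop, hne]
  refine (Finset.sum_le_sum fun i _ => key i).trans ?_
  rw [Fin.sum_univ_eq_sum_range (fun i => if r ≤ i then 1 else 0) (n - r),
    ← Finset.sum_filter, Finset.sum_const, smul_eq_mul, mul_one]
  have hsub : (Finset.range (n - r)).filter (fun i => r ≤ i) = Finset.Ico r (n - r) := by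
    ext i
    simp only [Finset.mem_filter, Finset.mem_range, Finset.mem_Ico]
    omega
  rw [hsub, Nat.card_Ico]
  omega

end NInvar

namespace NInvar

open MvPolynomial

/-! ### Corner minors -/

/-! Up to sign, `E_{0,r}` is the lower left `r × r` minor (`chopCoeff_zero_eq`). For `r ≤ n/2` this
corner lies strictly below the diagonal, so `π₋` does not touch it, and its minor is unchanged by
upper unipotent factors on either side. Hence each `E_{0,r}` is invariant, and its degree is
visible.

Conversely, where all corner minors are nonzero, Gaussian elimination inside `N` clears every entry
below the diagonal except on the antidiagonal; the surviving entries are ratios of consecutive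
minors. So equal nonzero minors force equal values of all invariants (`invEq_of_det_corner_eq`).

The antidiagonal form has denominators. The points `companion d` depend polynomially on `d` and have
corner minors `d`. This section gives algebraic independence at once, and composing an invariant
with it gives the polynomial in the generators. The two sides agree where no minor vanishes, hence
everywhere. -/

/-- The lower left `r × r` corner of a matrix, with the order of the rows reversed. -/
def corner {A : Type*} {n r : ℕ} (h : r ≤ n) (M : Matrix (Fin n) (Fin n) A) :
    Matrix (Fin r) (Fin r) A :=
  M.submatrix (fun i => (Fin.castLE h i).rev) (Fin.castLE h)

theorem submatrix_mul_of_left {A l m n p : Type*} [CommRing A] [Fintype m] [Fintype n]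
    (P : Matrix n n A) (M : Matrix n p A) (e : m → n) (he : Function.Injective e) (c : l → p)
    (hP : ∀ i, ∀ a ∉ Set.range e, P (e i) a = 0) :
    (P * M).submatrix e c = P.submatrix e e * M.submatrix e c := by
  ext i j
  simp only [Matrix.submatrix_apply, Matrix.mul_apply]
  exact (Fintype.sum_of_injective e he _ _ (fun a ha => by simp [hP i a ha]) fun _ => rfl).symm

theorem submatrix_mul_of_right {A l m n p : Type*} [CommRing A] [Fintype m] [Fintype n]
    (M : Matrix p n A) (Q : Matrix n n A) (e : m → n) (he : Function.Injective e) (c : l → p)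
    (hQ : ∀ j, ∀ a ∉ Set.range e, Q a (e j) = 0) :
    (M * Q).submatrix c e = M.submatrix c e * Q.submatrix e e := by
  ext i j
  simp only [Matrix.submatrix_apply, Matrix.mul_apply]
  exact (Fintype.sum_of_injective e he _ _ (fun a ha => by simp [hQ j a ha]) fun _ => rfl).symm

/-- The last `r` rows of `P` are supported on the last `r` columns, and the first `r` columns of `Q`
on the first `r` rows. The corner of the product is therefore a product of three `r × r` matrices,
the outer two being triangular with unit diagonal. Reversing the rows makes the block of `P` lower
triangular. -/
theorem det_corner_mul_mul {n r : ℕ} (h : r ≤ n) {P Q : Matrix (Fin n) (Fin n) ℝ}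
    (hP : IsUpperUnipotent P) (hQ : IsUpperUnipotent Q) (M : Matrix (Fin n) (Fin n) ℝ) :
    (corner h (P * M * Q)).det = (corner h M).det := by
  have h1 : Function.Injective fun i : Fin r => (Fin.castLE h i).rev :=
    Fin.rev_injective.comp (Fin.castLE_injective h)
  have h2 := Fin.castLE_injective h
  rw [corner, submatrix_mul_of_right _ _ _ h2, submatrix_mul_of_left _ _ _ h1, Matrix.det_mul,
    Matrix.det_mul]
  · have hp : (P.submatrix (fun i : Fin r => (Fin.castLE h i).rev)
        (fun i : Fin r => (Fin.castLE h i).rev)).det = 1 := by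
      rw [Matrix.det_of_isLowerTriangular]
      · simp [hP.2]
      · intro i j hij
        apply hP.1
        simpa using hij
    have hq : (Q.submatrix (Fin.castLE h) (Fin.castLE h)).det = 1 := by
      rw [Matrix.det_of_isUpperTriangular]
      · simp [hQ.2]
      · intro i j hij
        apply hQ.1
        simpa using hij
    rw [hp, hq, one_mul, mul_one, corner]
  · intro i a ha
    apply hP.1
    by_contra hlt
    refine ha ⟨⟨n - 1 - a, ?_⟩, ?_⟩
    · simp only [Fin.lt_def, Fin.val_rev, Fin.val_castLE] at hlt
      omega
    · ext
      simp only [Fin.val_rev, Fin.val_castLE]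
      omega
  · intro j a ha
    apply hQ.1
    by_contra hlt
    refine ha ⟨⟨a, ?_⟩, ?_⟩
    · simp only [Fin.lt_def, Fin.val_castLE] at hlt
      omega
    · ext
      simp

/-- Corner positions have row `n - 1 - i` and column `j` with `i, j < r`, and `i + j ≤ 2r - 2 < n -
1`. -/
theorem corner_lowerProj {n r : ℕ} (hr : r ≤ n / 2) (M : Matrix (Fin n) (Fin n) ℝ) :
    corner (hr.trans (Nat.div_le_self n 2)) (lowerProj n M : Matrix (Fin n) (Fin n) ℝ) =
      corner (hr.trans (Nat.div_le_self n 2)) M := by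
  ext i j
  simp only [corner, lowerProj, Matrix.submatrix_apply, LinearMap.coe_mk, AddHom.coe_mk,
    Matrix.of_apply]
  rw [if_pos]
  simp only [Fin.lt_def, Fin.val_rev, Fin.val_castLE]
  omega

theorem det_corner_coadjoint {n r : ℕ} (hr : r ≤ n / 2) (g : upperUnipotent n)
    (X : lowerNilp n) :
    (corner (hr.trans (Nat.div_le_self n 2)) (coadjoint g X : Matrix (Fin n) (Fin n) ℝ)).det =
      (corner (hr.trans (Nat.div_le_self n 2)) (X : Matrix (Fin n) (Fin n) ℝ)).det := by
  rw [coadjoint, corner_lowerProj hr]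
  exact det_corner_mul_mul _ ((upperUnipotent n).inv_mem g.2) g.2 _

/-! ### Leading coefficients of chop determinants as signed corner minors -/

/-- The equivalence which lists the rows of the `r`-chop that meet the diagonal, followed by the
remaining rows in reversed order. -/
def chopRowEquiv {n r : ℕ} (hr : r ≤ n / 2) : Fin (n - 2 * r) ⊕ Fin r ≃ Fin (n - r) where
  toFun := Sum.elim (fun i => ⟨i, by omega⟩) fun i => ⟨n - r - 1 - i, by omega⟩
  invFun k := if h : k.1 < n - 2 * r then Sum.inl ⟨k, h⟩ else Sum.inr ⟨n - r - 1 - k, by omega⟩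
  left_inv := by
    rintro (i | i)
    · simp
    · have : ¬ (n - r - 1 - i.1 < n - 2 * r) := by omega
      refine (dif_neg this).trans (congrArg Sum.inr ?_)
      ext
      simp only [Sum.elim_inr]
      omega
  right_inv := by
    intro k
    by_cases h : k.1 < n - 2 * r
    · simp [h]
    · simp only [h, dite_false, Sum.elim_inr, Fin.ext_iff]
      omega

/-- The equivalence which lists the columns of the `r`-chop that meet the diagonal, followed by
the first `r` columns. -/
def chopColEquiv {n r : ℕ} (hr : r ≤ n / 2) : Fin (n - 2 * r) ⊕ Fin r ≃ Fin (n - r) where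
  toFun := Sum.elim (fun i => ⟨r + i, by omega⟩) fun i => ⟨i, by omega⟩
  invFun k := if h : k.1 < r then Sum.inr ⟨k, h⟩ else Sum.inl ⟨k - r, by omega⟩
  left_inv := by
    rintro (i | i) <;> simp
  right_inv := by
    intro k
    by_cases h : k.1 < r
    · simp [h]
    · simp only [h, dite_false, Sum.elim_inl, Fin.ext_iff]
      omega

/-- The sign which relates `E_{0,r}` and the corner minor of size `r`. -/
def cornerSign {n r : ℕ} (hr : r ≤ n / 2) : ℤˣ :=
  Equiv.Perm.sign ((chopRowEquiv hr).symm.trans (chopColEquiv hr)) * (-1) ^ (n - 2 * r)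

/-- After reordering, `η` occurs only in the upper left block, as `-η` times the identity.
Multiplying the last `r` rows by `η` makes the matrix `η S + T` with constant `S` and `T`, at the
cost of a factor `η ^ r`. The top coefficient of its determinant is `det S`, and `S` is block
triangular with diagonal blocks `-1` and the corner. -/
theorem chopCoeff_zero_eq {A : Type*} [CommRing A] {n r : ℕ} (hr : r ≤ n / 2)
    (M : Matrix (Fin n) (Fin n) A) :
    chopCoeff 0 r M =
      ((cornerSign hr : ℤ) : A) * (corner (hr.trans (Nat.div_le_self n 2)) M).det := by
  set σ : Equiv.Perm (Fin (n - r)) := (chopRowEquiv hr).symm.trans (chopColEquiv hr) with hσ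
  set N : Matrix (Fin (n - r)) (Fin (n - r)) (Polynomial A) :=
    chop r (M.map Polynomial.C - (Polynomial.X : Polynomial A) • 1) with hN
  set K := N.submatrix (chopRowEquiv hr) (chopColEquiv hr) with hK
  have hdetK : K.det = (Equiv.Perm.sign σ : ℤ) * N.det := by
    rw [← Matrix.det_permute' σ N, ← Matrix.det_submatrix_equiv_self (chopRowEquiv hr)]
    congr 1
    ext1 i j
    simp [hK, hσ]
  set S : Matrix (Fin (n - 2 * r) ⊕ Fin r) (Fin (n - 2 * r) ⊕ Fin r) A :=
    Matrix.fromBlocks (-1) 0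
      (Matrix.of fun i j => M ⟨n - 1 - i, by omega⟩ ⟨r + j, by omega⟩)
      (corner (hr.trans (Nat.div_le_self n 2)) M) with hS
  set T : Matrix (Fin (n - 2 * r) ⊕ Fin r) (Fin (n - 2 * r) ⊕ Fin r) A :=
    Matrix.fromBlocks
      (Matrix.of fun i j => M ⟨r + i, by omega⟩ ⟨r + j, by omega⟩)
      (Matrix.of fun i j => M ⟨r + i, by omega⟩ ⟨j, by omega⟩) 0 0 with hT
  set v : Fin (n - 2 * r) ⊕ Fin r → Polynomial A := Sum.elim 1 fun _ => Polynomial.X with hv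
  have key : Matrix.diagonal v * K =
      (Polynomial.X : Polynomial A) • S.map Polynomial.C + T.map Polynomial.C := by
    ext1 i j
    rw [Matrix.diagonal_mul]
    rcases i with i | i <;> rcases j with j | j
    · by_cases h : i = j
      · subst h
        simp [hv, hK, hN, hS, hT, chop, chopRowEquiv, chopColEquiv]
        ring
      · have h' : i.1 ≠ j.1 := fun e => h (Fin.ext e)
        simp [hv, hK, hN, hS, hT, chop, chopRowEquiv, chopColEquiv, h, h']
    · have h : r + i.1 ≠ j.1 := by omega
      simp [hv, hK, hN, hS, hT, chop, chopRowEquiv, chopColEquiv, h]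
    · have h : r + (n - r - 1 - i.1) ≠ r + j.1 := by omega
      have h2 : r + (n - r - 1 - i.1) = n - 1 - i.1 := by omega
      have h3 : n - 1 - i.1 ≠ r + j.1 := by omega
      simp [hv, hK, hN, hS, hT, chop, chopRowEquiv, chopColEquiv, h2, h3]
    · have h2 : r + (n - r - 1 - i.1) = n - 1 - i.1 := by omega
      have h3 : n - 1 - i.1 ≠ j.1 := by omega
      have h4 : (Fin.castLE (hr.trans (Nat.div_le_self n 2)) i).rev =
          ⟨n - 1 - i.1, by omega⟩ := by
        ext
        simp only [Fin.val_rev, Fin.val_castLE]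
        omega
      have h5 : Fin.castLE (hr.trans (Nat.div_le_self n 2)) j = ⟨j.1, by omega⟩ := rfl
      simp [hv, hK, hN, hS, hT, chop, chopRowEquiv, chopColEquiv, h2, h3, corner, h4, h5]
  have hcoeff := Polynomial.coeff_det_X_add_C_card S T
  have hvdet : (Matrix.diagonal v).det = (Polynomial.X : Polynomial A) ^ r := by
    simp [Matrix.det_diagonal, hv]
  have hcard : Fintype.card (Fin (n - 2 * r) ⊕ Fin r) = (n - 2 * r) + r := by simp
  have hSdet : S.det = (-1) ^ (n - 2 * r) * (corner (hr.trans (Nat.div_le_self n 2)) M).det := by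
    rw [hS, Matrix.det_fromBlocks_zero₁₂, Matrix.det_neg]
    simp
  rw [← key, Matrix.det_mul, hvdet, hcard, Polynomial.coeff_X_pow_mul, hdetK, hSdet,
    Polynomial.coeff_intCast_mul] at hcoeff
  have hsq : ((Equiv.Perm.sign σ : ℤ) : A) * ((Equiv.Perm.sign σ : ℤ) : A) = 1 := by
    rw [← Int.cast_mul, ← Units.val_mul, Int.units_mul_self]
    simp
  rw [chopCoeff, chopDet, Nat.sub_zero, ← hN, ← one_mul (N.det.coeff _), ← hsq, mul_assoc, hcoeff,
    cornerSign]
  push_cast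
  ring

theorem cornerSign_mul_self {n r : ℕ} (hr : r ≤ n / 2) (A : Type*) [CommRing A] :
    ((cornerSign hr : ℤ) : A) * ((cornerSign hr : ℤ) : A) = 1 := by
  rw [← Int.cast_mul, ← Units.val_mul, Int.units_mul_self]
  simp

theorem isHomogeneous_leadCoeff {n r : ℕ} (hr : r ≤ n / 2) :
    (leadCoeff n r).IsHomogeneous r := by
  rw [leadCoeff, chopCoeff_zero_eq hr, ← map_intCast (C : ℝ →+* PolyOnLower n),
    Matrix.det_apply]
  refine IsHomogeneous.C_mul (IsHomogeneous.sum _ _ _ fun s _ => ?_) _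
  rw [Units.smul_def, zsmul_eq_mul, ← map_intCast (C : ℝ →+* PolyOnLower n)]
  refine IsHomogeneous.C_mul ?_ _
  have := IsHomogeneous.prod (Finset.univ : Finset (Fin r))
    (fun i => corner (hr.trans (Nat.div_le_self n 2)) (genericLower n) (s i) i) (fun _ => 1)
    fun i _ => by
      simp only [corner, genericLower, Matrix.submatrix_apply, Matrix.of_apply]
      split_ifs
      · exact isHomogeneous_X _ _
      · exact isHomogeneous_zero _ _ _
  simpa using this

theorem leadCoeff_mem_invariants {n r : ℕ} (hr : r ≤ n / 2) : leadCoeff n r ∈ invariants n := by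
  intro g X
  rw [eval_leadCoeff, eval_leadCoeff, chopCoeff_zero_eq hr, chopCoeff_zero_eq hr,
    det_corner_coadjoint hr]

/-! ### Reduction to antidiagonal form -/

/-- The element `1 + B` of `N`, for `B` strictly upper triangular with `B * B = 0`. -/
def oneAdd {n : ℕ} (B : Matrix (Fin n) (Fin n) ℝ) (hB : ∀ i j, j ≤ i → B i j = 0)
    (h2 : B * B = 0) : upperUnipotent n :=
  ⟨⟨1 + B, 1 - B, by simp [mul_sub, add_mul, h2], by simp [mul_add, sub_mul, h2]⟩,
    fun i j h => by simp [hB i j h.le, Matrix.one_apply_ne h.ne'],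
    fun i => by simp [hB i i le_rfl]⟩

theorem coadjoint_oneAdd {n : ℕ} (B : Matrix (Fin n) (Fin n) ℝ)
    (hB : ∀ i j, j ≤ i → B i j = 0) (h2 : B * B = 0) (X : lowerNilp n) {i j : Fin n}
    (h : j < i) :
    (coadjoint (oneAdd B hB h2) X : Matrix (Fin n) (Fin n) ℝ) i j =
      X.1 i j + (X.1 * B) i j - (B * (X.1 + X.1 * B)) i j := by
  have : (coadjoint (oneAdd B hB h2) X : Matrix (Fin n) (Fin n) ℝ) i j =
      ((1 - B) * X.1 * (1 + B)) i j := by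
    simp only [coadjoint, lowerProj, LinearMap.coe_mk, AddHom.coe_mk, Matrix.of_apply, if_pos h]
    rfl
  rw [this, Matrix.mul_assoc, mul_add, mul_one, sub_mul, one_mul, Matrix.sub_apply,
    Matrix.add_apply]

/-- The entries of `X` below the diagonal and off the antidiagonal vanish in the first `p` columns
and in the last `q` rows. -/
def IsReduced {n : ℕ} (p q : ℕ) (X : lowerNilp n) : Prop :=
  ∀ i j : Fin n, j < i → (j.1 < p ∨ n - 1 - i.1 < q) → i.1 + j.1 ≠ n - 1 → X.1 i j = 0

/-- All invariant polynomials take the same value at the two points. -/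
def InvEq {n : ℕ} (X Y : lowerNilp n) : Prop :=
  ∀ f ∈ invariants n, eval (coords X) f = eval (coords Y) f

theorem InvEq.trans {n : ℕ} {X Y Z : lowerNilp n} (h : InvEq X Y) (h' : InvEq Y Z) :
    InvEq X Z :=
  fun f hf => (h f hf).trans (h' f hf)

theorem invEq_coadjoint {n : ℕ} (g : upperUnipotent n) (X : lowerNilp n) :
    InvEq X (coadjoint g X) :=
  fun _ hf => (hf g X).symm

theorem InvEq.det_corner_eq {n r : ℕ} (hr : r ≤ n / 2) {X Y : lowerNilp n} (h : InvEq X Y) :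
    (corner (hr.trans (Nat.div_le_self n 2)) X.1).det =
      (corner (hr.trans (Nat.div_le_self n 2)) Y.1).det := by
  have := h _ (leadCoeff_mem_invariants hr)
  rw [eval_leadCoeff, eval_leadCoeff, chopCoeff_zero_eq hr, chopCoeff_zero_eq hr] at this
  have h1 := congrArg (((cornerSign hr : ℤ) : ℝ) * ·) this
  simpa only [← mul_assoc, cornerSign_mul_self, one_mul] using h1

/-- The bounds allow `r = p + 1` because two distinct indices below `r` cannot both equal `r - 1`,
so every off-diagonal corner entry already lies in a cleared row or column. This slack lets the next
minor detect the next pivot. -/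
theorem IsReduced.det_corner {n p q r : ℕ} {X : lowerNilp n} (hX : IsReduced p q X)
    (hr : r ≤ n / 2) (hp : r ≤ p + 1) (hq : r ≤ q + 1) :
    (corner (hr.trans (Nat.div_le_self n 2)) X.1).det =
      ∏ i : Fin r, X.1 ⟨n - 1 - i, by omega⟩ ⟨i, by omega⟩ := by
  have : corner (hr.trans (Nat.div_le_self n 2)) X.1 =
      Matrix.diagonal fun i : Fin r => X.1 ⟨n - 1 - i, by omega⟩ ⟨i, by omega⟩ := by
    ext i j
    have h4 : (Fin.castLE (hr.trans (Nat.div_le_self n 2)) i).rev =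
        ⟨n - 1 - i.1, by omega⟩ := by
      ext
      simp only [Fin.val_rev, Fin.val_castLE]
      omega
    have h5 : Fin.castLE (hr.trans (Nat.div_le_self n 2)) j = ⟨j.1, by omega⟩ := rfl
    rw [corner, Matrix.submatrix_apply, h4, h5]
    by_cases h : i = j
    · subst h
      simp
    · have h' : i.1 ≠ j.1 := fun e => h (Fin.ext e)
      rw [Matrix.diagonal_apply_ne _ h]
      apply hX
      · simp only [Fin.lt_def]
        omega
      · simp only
        omega
      · simp only
        omega
  rw [this, Matrix.det_diagonal]

/-- One elimination step with pivot `(t, s)`: right multiplication by `1 + B` adds multiples of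
column `s` to the columns strictly between `s` and `t`, clearing row `t` there. -/
theorem exists_isReduced_row {n r : ℕ} (hr : r < n / 2) {X : lowerNilp n}
    (hX : IsReduced r r X) (hx : X.1 ⟨n - 1 - r, by omega⟩ ⟨r, by omega⟩ ≠ 0) :
    ∃ Y, InvEq X Y ∧ IsReduced r (r + 1) Y := by
  set s : Fin n := ⟨r, by omega⟩ with hs
  set t : Fin n := ⟨n - 1 - r, by omega⟩ with ht
  set b : Fin n → ℝ := fun j => if s < j ∧ j < t then -X.1 t j / X.1 t s else 0 with hb
  have hb0 : ∀ j, ¬ (s < j ∧ j < t) → b j = 0 := fun j h => if_neg h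
  set B : Matrix (Fin n) (Fin n) ℝ := Matrix.vecMulVec (Pi.single s 1) b with hBdef
  have hB : ∀ i j, j ≤ i → B i j = 0 := by
    intro i j h
    by_cases hi : i = s
    · subst hi
      simp [hBdef, Matrix.vecMulVec_apply, hb0 j fun h' => absurd h'.1 (not_lt.mpr h)]
    · simp [hBdef, Matrix.vecMulVec_apply, hi]
  have hBB : B * B = 0 := by
    rw [hBdef, Matrix.vecMulVec_mul_vecMulVec]
    have : b ⬝ᵥ Pi.single s 1 = 0 := by simp [hb0 s (by simp)]
    simp [this]
  have hXB : ∀ i j, (X.1 * B) i j = X.1 i s * b j := by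
    intro i j
    simp [hBdef, Matrix.mul_vecMulVec, Matrix.vecMulVec_apply]
  -- Left multiplication by `1 - B` alters only row `s`, by combinations of rows strictly between
  -- `s` and `t`. In columns `j < s` these rows are already zero, their antidiagonal entries lying
  -- in columns beyond `s`.
  have hBX : ∀ i j, j < i → (B * (X.1 + X.1 * B)) i j = 0 := by
    intro i j hij
    rw [hBdef, Matrix.vecMulVec_mul, Matrix.vecMulVec_apply]
    by_cases hi : i = s
    · subst hi
      have : (b ᵥ* (X.1 + X.1 * Matrix.vecMulVec (Pi.single s 1) b)) j = 0 := by
        simp only [Matrix.vecMul, dotProduct, Matrix.add_apply, ← hBdef, hXB]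
        refine Finset.sum_eq_zero fun m _ => ?_
        rw [hb0 j fun h' => absurd h'.1 (not_lt.mpr hij.le)]
        by_cases hm : s < m ∧ m < t
        · rw [hX m j (hij.trans hm.1) (Or.inl hij) ?_]
          · simp
          · have h1 := hm.2
            simp only [Fin.lt_def, ht, hs] at h1 hij
            omega
        · simp [hb0 m hm]
      rw [this, mul_zero]
    · simp [hi]
  refine ⟨coadjoint (oneAdd B hB hBB) X, invEq_coadjoint _ _, fun i j hij hor hne => ?_⟩
  rw [coadjoint_oneAdd _ _ _ _ hij, hXB, hBX i j hij, sub_zero]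
  by_cases hi : i = t
  · subst hi
    by_cases hj : s < j
    · have : b j = -X.1 t j / X.1 t s := if_pos ⟨hj, hij⟩
      rw [this]
      field_simp
      ring
    · rw [hb0 j fun h => hj h.1, mul_zero, add_zero]
      refine hX _ _ hij (Or.inl ?_) hne
      simp only [Fin.lt_def, ht, hs] at hj hne ⊢
      omega
  · have hi' : i.1 ≠ n - 1 - r := fun e => hi (Fin.ext e)
    rw [hX i j hij (by omega) hne, zero_add]
    by_cases hj : s < j ∧ j < t
    · obtain ⟨hj1, hj2⟩ := hj
      simp only [Fin.lt_def, ht, hs] at hj1 hj2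
      rw [hX i s, zero_mul]
      · simp only [Fin.lt_def, hs]
        omega
      · omega
      · simp only [hs]
        omega
    · rw [hb0 j hj, mul_zero]

/-- Now row `t` has only the pivot below the diagonal, so subtracting multiples of it from the rows
strictly between `s` and `t` changes nothing below the diagonal but column `s`. -/
theorem exists_isReduced_col {n r : ℕ} (hr : r < n / 2) {X : lowerNilp n}
    (hX : IsReduced r (r + 1) X) (hx : X.1 ⟨n - 1 - r, by omega⟩ ⟨r, by omega⟩ ≠ 0) :
    ∃ Y, InvEq X Y ∧ IsReduced (r + 1) (r + 1) Y := by
  set s : Fin n := ⟨r, by omega⟩ with hs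
  set t : Fin n := ⟨n - 1 - r, by omega⟩ with ht
  set a : Fin n → ℝ := fun i => if s < i ∧ i < t then X.1 i s / X.1 t s else 0 with ha
  have ha0 : ∀ i, ¬ (s < i ∧ i < t) → a i = 0 := fun j h => if_neg h
  set B : Matrix (Fin n) (Fin n) ℝ := Matrix.vecMulVec a (Pi.single t 1) with hBdef
  have hB : ∀ i j, j ≤ i → B i j = 0 := by
    intro i j h
    by_cases hj : j = t
    · subst hj
      simp [hBdef, Matrix.vecMulVec_apply, ha0 i fun h' => absurd h'.2 (not_lt.mpr h)]
    · simp [hBdef, Matrix.vecMulVec_apply, hj]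
  have hBB : B * B = 0 := by
    rw [hBdef, Matrix.vecMulVec_mul_vecMulVec]
    have : Pi.single t 1 ⬝ᵥ a = 0 := by simp [ha0 t (by simp)]
    simp [this]
  -- Right multiplication alters only column `t`. Below the diagonal this involves rows `i > t`,
  -- which are already cleared in the columns where `a` lives.
  have hXB : ∀ i j, j < i → (X.1 * B) i j = 0 := by
    intro i j hij
    rw [hBdef, Matrix.mul_vecMulVec, Matrix.vecMulVec_apply]
    by_cases hj : j = t
    · subst hj
      have : (X.1 *ᵥ a) i = 0 := by
        simp only [Matrix.mulVec, dotProduct]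
        refine Finset.sum_eq_zero fun m _ => ?_
        by_cases hm : s < m ∧ m < t
        · have h1 := hm.1
          have h2 := hm.2
          simp only [Fin.lt_def, ht, hs] at h1 h2 hij
          rw [hX i m (by simp only [Fin.lt_def]; omega) (Or.inr (by omega)) (by omega), zero_mul]
        · rw [ha0 m hm, mul_zero]
      rw [this, zero_mul]
    · simp [hj]
  have hBX : ∀ i j, j < i → (B * (X.1 + X.1 * B)) i j = a i * X.1 t j := by
    intro i j hij
    by_cases hi : s < i ∧ i < t
    · have := hXB t j (hij.trans hi.2)
      simp only [hBdef] at this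
      rw [hBdef, Matrix.vecMulVec_mul, Matrix.vecMulVec_apply, Matrix.single_one_vecMul,
        Matrix.row_apply, Matrix.add_apply, this, add_zero]
    · rw [hBdef, Matrix.vecMulVec_mul, Matrix.vecMulVec_apply, ha0 i hi, zero_mul, zero_mul]
  refine ⟨coadjoint (oneAdd B hB hBB) X, invEq_coadjoint _ _, fun i j hij hor hne => ?_⟩
  rw [coadjoint_oneAdd _ _ _ _ hij, hXB i j hij, hBX i j hij, add_zero]
  by_cases hi : s < i ∧ i < t
  · obtain ⟨hi1, hi2⟩ := hi
    by_cases hj : j = s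
    · subst hj
      have : a i = X.1 i s / X.1 t s := if_pos ⟨hi1, hi2⟩
      rw [this]
      field_simp
      ring
    · have hj' : j.1 ≠ r := fun e => hj (Fin.ext e)
      have h1 := hi1
      have h2 := hi2
      simp only [Fin.lt_def, ht, hs] at h1 h2
      rw [hX i j hij (by omega) hne, hX t j (hij.trans hi2) (Or.inr (by simp only [ht]; omega))
        (by simp only [ht]; omega)]
      simp
  · rw [ha0 i hi, zero_mul, sub_zero]
    refine hX i j hij ?_ hne
    simp only [Fin.lt_def, ht, hs, not_and, not_lt] at hi hij
    omega

theorem IsReduced.mono {n p q p' q' : ℕ} {X : lowerNilp n} (hX : IsReduced p q X)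
    (hp : p' ≤ p) (hq : q' ≤ q) : IsReduced p' q' X :=
  fun i j hij h hne => hX i j hij (h.imp (fun h => h.trans_le hp) fun h => h.trans_le hq) hne

theorem IsReduced.antidiag_ne_zero {n r : ℕ} (hr : r < n / 2) {X : lowerNilp n}
    (hX : IsReduced r r X) (hd : (corner (hr.trans_le (Nat.div_le_self n 2)) X.1).det ≠ 0) :
    X.1 ⟨n - 1 - r, by omega⟩ ⟨r, by omega⟩ ≠ 0 := by
  rw [hX.det_corner (r := r + 1) hr le_rfl le_rfl, Fin.prod_univ_castSucc] at hd
  exact right_ne_zero_of_mul hd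

theorem exists_isReduced {n : ℕ} {X : lowerNilp n}
    (hd : ∀ r (hr : r ≤ n / 2), (corner (hr.trans (Nat.div_le_self n 2)) X.1).det ≠ 0) :
    ∀ r ≤ n / 2, ∃ Y, InvEq X Y ∧ IsReduced r r Y := by
  intro r
  induction r with
  | zero => exact fun _ => ⟨X, fun _ _ => rfl, fun i j _ h => by omega⟩
  | succ r ih =>
    intro hr
    obtain ⟨Y, hXY, hY⟩ := ih (Nat.le_of_succ_le hr)
    obtain ⟨Z, hYZ, hZ⟩ := exists_isReduced_row hr hY
      (hY.antidiag_ne_zero hr (hXY.det_corner_eq hr ▸ hd _ hr))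
    have hXZ := hXY.trans hYZ
    obtain ⟨W, hZW, hW⟩ := exists_isReduced_col hr hZ
      ((hZ.mono le_rfl r.le_succ).antidiag_ne_zero hr (hXZ.det_corner_eq hr ▸ hd _ hr))
    exact ⟨W, hXZ.trans hZW, hW⟩

/-- Each minor is the product of the first antidiagonal entries, so cancelling the preceding nonzero
minor recovers these entries one at a time. -/
theorem IsReduced.ext {n : ℕ} {X Y : lowerNilp n} (hX : IsReduced (n / 2) (n / 2) X)
    (hY : IsReduced (n / 2) (n / 2) Y)
    (hd : ∀ r (hr : r ≤ n / 2), (corner (hr.trans (Nat.div_le_self n 2)) X.1).det ≠ 0)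
    (h : ∀ r (hr : r ≤ n / 2), (corner (hr.trans (Nat.div_le_self n 2)) X.1).det =
      (corner (hr.trans (Nat.div_le_self n 2)) Y.1).det) : X = Y := by
  have key : ∀ r (hr : r < n / 2), X.1 ⟨n - 1 - r, by omega⟩ ⟨r, by omega⟩ =
      Y.1 ⟨n - 1 - r, by omega⟩ ⟨r, by omega⟩ := by
    intro r hr
    have h0 := h r hr.le
    have h1 := h (r + 1) hr
    have h2 := hd r hr.le
    rw [hX.det_corner hr.le (by omega) (by omega)] at h0 h2
    rw [hX.det_corner (r := r + 1) hr (by omega) (by omega), Fin.prod_univ_castSucc,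
      hY.det_corner (r := r + 1) hr (by omega) (by omega), Fin.prod_univ_castSucc] at h1
    rw [hY.det_corner hr.le (by omega) (by omega)] at h0
    simp only [Fin.val_castSucc, Fin.val_last] at h1
    rw [← h0] at h1
    exact mul_left_cancel₀ h2 h1
  ext i j
  by_cases hij : j < i
  · have hij' := hij
    simp only [Fin.lt_def] at hij'
    by_cases hne : i.1 + j.1 = n - 1
    · have := key j.1 (by omega)
      have hi : (⟨n - 1 - j.1, by omega⟩ : Fin n) = i := by
        ext
        simp only
        omega
      rwa [hi] at this
    · rw [hX i j hij (by omega) hne, hY i j hij (by omega) hne]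
  · rw [X.2 i j (not_lt.mp hij), Y.2 i j (not_lt.mp hij)]

theorem invEq_of_det_corner_eq {n : ℕ} {X Y : lowerNilp n}
    (hd : ∀ r (hr : r ≤ n / 2), (corner (hr.trans (Nat.div_le_self n 2)) X.1).det ≠ 0)
    (h : ∀ r (hr : r ≤ n / 2), (corner (hr.trans (Nat.div_le_self n 2)) X.1).det =
      (corner (hr.trans (Nat.div_le_self n 2)) Y.1).det) : InvEq X Y := by
  obtain ⟨X', hX, hX'⟩ := exists_isReduced hd _ le_rfl
  obtain ⟨Y', hY, hY'⟩ := exists_isReduced (X := Y) (fun r hr => h r hr ▸ hd r hr) _ le_rfl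
  have : X' = Y' := hX'.ext hY' (fun r hr => hX.det_corner_eq hr ▸ hd r hr)
    fun r hr => by rw [← hX.det_corner_eq hr, h r hr, hY.det_corner_eq hr]
  subst this
  exact fun f hf => (hX f hf).trans (hY f hf).symm

/-! ### A polynomial section of the corner minors -/

/-- The point of `𝔫₋` whose last row starts with `d`, and which has entries `-1` next to the
antidiagonal, on the side of the diagonal. -/
noncomputable def companion {n : ℕ} (d : Fin (n / 2) → ℝ) : lowerNilp n :=
  lowerProj n <| Matrix.of fun i j =>
    if i.1 = n - 1 then if h : j.1 < n / 2 then d ⟨j, h⟩ else 0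
    else if n - 1 - i.1 = j.1 + 1 then -1 else 0

/-- The corner has first row `d` and `-1` just below its diagonal. Its last column has the single
nonzero candidate `d r` at the top, whose complementary minor is `det (-1) = (-1) ^ r`; this cancels
the cofactor sign. -/
theorem det_corner_companion {n r : ℕ} (hr : r < n / 2) (d : Fin (n / 2) → ℝ) :
    (corner (Nat.succ_le_of_lt (hr.trans_le (Nat.div_le_self n 2))) (companion d).1).det =
      d ⟨r, hr⟩ := by
  rw [companion, corner_lowerProj (r := r + 1) hr, Matrix.det_succ_column _ (Fin.last r),
    Finset.sum_eq_single 0]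
  · have h1 : (Matrix.submatrix (corner (Nat.succ_le_of_lt (hr.trans_le (Nat.div_le_self n 2)))
        (Matrix.of fun i j : Fin n => if i.1 = n - 1 then if h : j.1 < n / 2 then d ⟨j, h⟩ else 0
          else if n - 1 - i.1 = j.1 + 1 then (-1 : ℝ) else 0))
        (Fin.succAbove 0) (Fin.last r).succAbove) = -1 := by
      ext i j
      have e1 : n - (i.1 + 1 + 1) ≠ n - 1 := by omega
      have e2 : n - 1 - (n - (i.1 + 1 + 1)) = i.1 + 1 := by omega
      by_cases h : i = j
      · subst h
        simp [corner, e1, e2]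
      · have h' : i.1 ≠ j.1 := fun e => h (Fin.ext e)
        simp [corner, e1, e2, h, h']
    rw [h1, Matrix.det_neg]
    simp [corner, hr, ← mul_pow, mul_right_comm]
  · intro i _ hi
    have hi' : i.1 ≠ 0 := fun e => hi (Fin.ext e)
    have e1 : n - (i.1 + 1) ≠ n - 1 := by omega
    have e2 : n - 1 - (n - (i.1 + 1)) ≠ r + 1 := by omega
    simp [corner, e1, e2]
  · simp

/-- The coordinates of `companion d`, as polynomials in `d`. -/
noncomputable def companionPoly (n : ℕ) (c : Fin (n / 2) → ℝ) (p : LowerIdx n) :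
    MvPolynomial (Fin (n / 2)) ℝ :=
  if p.1.1.1 = n - 1 then if h : p.1.2.1 < n / 2 then C (c ⟨p.1.2, h⟩) * X ⟨p.1.2, h⟩ else 0
  else if n - 1 - p.1.1.1 = p.1.2.1 + 1 then -1 else 0

theorem eval_companionPoly {n : ℕ} (c d : Fin (n / 2) → ℝ) (p : LowerIdx n) :
    eval d (companionPoly n c p) = coords (companion (c * d)) p := by
  have hp := p.2
  simp only [companionPoly, coords, companion, lowerProj, LinearMap.coe_mk, AddHom.coe_mk,
    Matrix.of_apply, if_pos hp]
  split_ifs <;> simp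

/-! ### Algebraic independence and generation -/

/-- The generators `E_{0,1}, …, E_{0,⌊n/2⌋}`. -/
noncomputable abbrev gens (n : ℕ) (r : Fin (n / 2)) : PolyOnLower n := leadCoeff n (r.1 + 1)

/-- The signs which relate the generators and the corner minors. -/
noncomputable def genSign (n : ℕ) (r : Fin (n / 2)) : ℝ :=
  ((cornerSign (n := n) (r := r.1 + 1) r.2 : ℤ) : ℝ)

theorem eval_gens {n : ℕ} (X : lowerNilp n) (r : Fin (n / 2)) :
    eval (coords X) (gens n r) = genSign n r *
      (corner (Nat.succ_le_of_lt (r.2.trans_le (Nat.div_le_self n 2))) X.1).det := by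
  rw [eval_leadCoeff, chopCoeff_zero_eq (r := r.1 + 1) r.2, genSign]

theorem genSign_mul_self {n : ℕ} (r : Fin (n / 2)) : genSign n r * genSign n r = 1 :=
  cornerSign_mul_self _ _

/-- Rescaling by the signs turns the section of the corner minors into a section of the generators.
-/
theorem eval_gens_companion {n : ℕ} (d : Fin (n / 2) → ℝ) (r : Fin (n / 2)) :
    eval (coords (companion (genSign n * d))) (gens n r) = d r := by
  rw [eval_gens, det_corner_companion r.2, Pi.mul_apply, ← mul_assoc, genSign_mul_self, one_mul]

theorem eval_aeval_eq {σ τ R : Type*} [CommRing R] (x : τ → R) (g : σ → MvPolynomial τ R)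
    (p : MvPolynomial σ R) : eval x (aeval g p) = eval (fun i => eval x (g i)) p := by
  induction p using MvPolynomial.induction_on with
  | C a => simp
  | add p q hp hq => rw [map_add, map_add, hp, hq, map_add]
  | mul_X p i hp => rw [map_mul, map_mul, hp, map_mul, aeval_X, eval_X]

theorem coords_surjective {n : ℕ} : Function.Surjective (coords (n := n)) := by
  intro x
  refine ⟨lowerProj n (Matrix.of fun i j => if h : j < i then x ⟨(i, j), h⟩ else 0), ?_⟩
  ext p
  simp [coords, lowerProj, p.2]

/-- Evaluated along the section, a relation `q` among the generators takes the value `q(d)` at every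
real point `d`, so it is zero. -/
theorem algebraicIndependent_gens (n : ℕ) : AlgebraicIndependent ℝ (gens n) := by
  rw [algebraicIndependent_iff]
  intro q hq
  refine MvPolynomial.funext fun d => ?_
  have := eval_aeval_eq (coords (companion (genSign n * d))) (gens n) q
  simp only [eval_gens_companion] at this
  rw [← this, hq, map_zero, map_zero]

theorem invariants_eq_adjoin (n : ℕ) :
    invariants n = Algebra.adjoin ℝ (Set.range (gens n)) := by
  refine le_antisymm (fun f hf => ?_) (Algebra.adjoin_le ?_)
  · rw [Algebra.adjoin_range_eq_range_aeval]
    refine ⟨aeval (companionPoly n (genSign n)) f, ?_⟩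
    -- Multiplying by this nonzero polynomial is harmless in a domain and makes the identity trivial
    -- at points where some generator vanishes, which the reduction does not reach.
    have hP : (∏ r, gens n r) ≠ 0 :=
      Finset.prod_ne_zero_iff.mpr fun r _ => (algebraicIndependent_gens n).ne_zero r
    refine mul_right_cancel₀ hP (MvPolynomial.funext fun x => ?_)
    obtain ⟨X, rfl⟩ := coords_surjective x
    rw [map_mul, map_mul, map_prod]
    by_cases h0 : ∀ r, eval (coords X) (gens n r) ≠ 0
    · congr 1
      set d : Fin (n / 2) → ℝ := fun r => eval (coords X) (gens n r) with hd
      have e1 : eval d (aeval (companionPoly n (genSign n)) f) =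
          eval (coords (companion (genSign n * d))) f := by
        rw [eval_aeval_eq]
        simp only [eval_companionPoly]
      refine (eval_aeval_eq _ _ _).trans (e1.trans ?_)
      -- `X` and the section point over its generator values have the same corner minors; the minor
      -- of size `0` is `1`.
      refine (invEq_of_det_corner_eq ?_ ?_ f hf).symm
      · rintro (_ | r) hr
        · simp
        · have := h0 ⟨r, hr⟩
          rw [eval_gens] at this
          exact right_ne_zero_of_mul this
      · rintro (_ | r) hr
        · simp
        · refine Eq.trans ?_ (det_corner_companion hr _).symm
          rw [Pi.mul_apply, hd]
          simp only
          rw [eval_gens, ← mul_assoc, genSign_mul_self, one_mul]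
    · push Not at h0
      obtain ⟨r, hr⟩ := h0
      rw [Finset.prod_eq_zero (Finset.mem_univ r) hr, mul_zero, mul_zero]
  · rintro _ ⟨r, rfl⟩
    exact leadCoeff_mem_invariants (r := r.1 + 1) r.2

end NInvar

theorem theorem3p3 (n : ℕ) :
    NInvar.invariants n =
        Algebra.adjoin ℝ (Set.range fun r : Fin (n / 2) => NInvar.leadCoeff n (r.1 + 1)) ∧
      AlgebraicIndependent ℝ (fun r : Fin (n / 2) => NInvar.leadCoeff n (r.1 + 1)) ∧
      ∀ r : Fin (n / 2), (NInvar.leadCoeff n (r.1 + 1)).IsHomogeneous (r.1 + 1) :=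
  ⟨NInvar.invariants_eq_adjoin n, NInvar.algebraicIndependent_gens n,
    fun r => NInvar.isHomogeneous_leadCoeff (r := r.1 + 1) r.2⟩
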